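/- For every constant $K>0$ there is a constant $c>0$, depending only on $K$, such that the following holds for every dimension $d$, every positive definite matrix $\Sigma\in\mathbb{R}^{d\times d}$ and all $\mu_0,\mu_1,\mu_0',\mu_1'\in\mathbb{R}^d$. Let $$f=\tfrac12\mathcal{N}(\mu_0,\Sigma)+\tfrac12\mathcal{N}(\mu_1,\Sigma),\qquad f'=\tfrac12\mathcal{N}(\mu_0',\Sigma)+\tfrac12\mathcal{N}(\mu_1',\Sigma),$$ and let $\|f-f'\|_{\mathrm{TV}}=\sup_A\big(f(A)-f'(A)\big)$, the supremum being over all Borel sets $A\subseteq\mathbb{R}^d$. Let $$S_1=\{\mu_1-\mu_0,\ \mu_1'-\mu_0'\},\quad S_2=\{\mu_0'-\mu_0,\ \mu_1'-\mu_1\},\quad S_3=\{\mu_0'-\mu_1,\ \mu_1'-\mu_0\},$$ let $v_i$ be a vector of largest Euclidean norm in $S_i$ for $i=1,2,3$ (ties broken arbitrarily), let $U=\operatorname{span}(v_1,v_2,v_3)$, and let $\lambda=\max\{u^{T}\Sigma u : u\in U,\ \|u\|_2=1\}$. (If all four means coincide, then $U=\{0\}$; in this trivial case $\lambda$ and the quotients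 below are read as $0$.) If $\|v_1\|_2\ge \min(\|v_2\|_2,\|v_3\|_2)/2$ and $\sqrt{\lambda}\ge K\|v_1\|_2$, then $$\|f-f'\|_{\mathrm{TV}}\ \ge\ c\,\min\Big(1,\ \frac{\|v_1\|_2\,\min(\|v_2\|_2,\|v_3\|_2)}{\lambda}\Big).$$ Otherwise, $$\|f-f'\|_{\mathrm{TV}}\ \ge\ c\,\min\Big(1,\ \frac{\min(\|v_2\|_2,\|v_3\|_2)}{\sqrt{\lambda}}\Big).$$ -/

import Mathlib

open MeasureTheory ProbabilityTheory
open scoped ENNReal Matrix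

/-- The equally weighted mixture `½ N(μ₀, S) + ½ N(μ₁, S)` on `ℝ^d`. -/
noncomputable def gaussianMixture {d : ℕ} (μ₀ μ₁ : EuclideanSpace ℝ (Fin d))
    (S : Matrix (Fin d) (Fin d) ℝ) : Measure (EuclideanSpace ℝ (Fin d)) :=
  (2⁻¹ : ℝ≥0∞) • multivariateGaussian μ₀ S + (2⁻¹ : ℝ≥0∞) • multivariateGaussian μ₁ S

/-- Total variation distance: the supremum of `f A - f' A` over measurable sets `A`. -/
noncomputable def tvDist {Ω : Type*} [MeasurableSpace Ω] (f f' : Measure Ω) : ℝ :=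
  sSup {r : ℝ | ∃ A : Set Ω, MeasurableSet A ∧ r = f.real A - f'.real A}

/-- `v` is a choice of `argmax_{s ∈ T} ‖s‖`. -/
def IsLongestIn {E : Type*} [Norm E] (T : Set E) (v : E) : Prop :=
  v ∈ T ∧ ∀ s ∈ T, ‖s‖ ≤ ‖v‖

/-- The values `uᵀ S u` over the unit vectors `u` of the subspace `U`. -/
def unitQuadValues {d : ℕ} (S : Matrix (Fin d) (Fin d) ℝ)
    (U : Submodule ℝ (EuclideanSpace ℝ (Fin d))) : Set ℝ :=
  {r | ∃ u : EuclideanSpace ℝ (Fin d), ‖u‖ = 1 ∧ u ∈ U ∧ r = u.ofLp ⬝ᵥ (S *ᵥ u.ofLp)}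

/-- The largest value of `uᵀ S u` over the unit vectors `u` of the subspace `U`. It is a maximum
whenever `U ≠ ⊥` (see `isGreatest_lambdaMax`), and `0` by convention for `U = ⊥`. -/
noncomputable def lambdaMax {d : ℕ} (S : Matrix (Fin d) (Fin d) ℝ)
    (U : Submodule ℝ (EuclideanSpace ℝ (Fin d))) : ℝ :=
  sSup (unitQuadValues S U)

theorem isGreatest_lambdaMax {d : ℕ} (S : Matrix (Fin d) (Fin d) ℝ)
    (U : Submodule ℝ (EuclideanSpace ℝ (Fin d))) (hU : U ≠ ⊥) :
    IsGreatest (unitQuadValues S U) (lambdaMax S U) := by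
  have himg : unitQuadValues S U =
      (fun u : EuclideanSpace ℝ (Fin d) => u.ofLp ⬝ᵥ (S *ᵥ u.ofLp)) ''
        (Metric.sphere 0 1 ∩ (U : Set (EuclideanSpace ℝ (Fin d)))) := by
    ext r
    simp only [unitQuadValues, Set.mem_ofPred_eq, Set.mem_image, Set.mem_inter_iff,
      mem_sphere_zero_iff_norm, SetLike.mem_coe]
    constructor
    · rintro ⟨u, h1, h2, h3⟩
      exact ⟨u, ⟨h1, h2⟩, h3.symm⟩
    · rintro ⟨u, ⟨h1, h2⟩, h3⟩
      exact ⟨u, h1, h2, h3.symm⟩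
  have hcpt : IsCompact (unitQuadValues S U) := by
    rw [himg]
    refine ((isCompact_sphere _ _).inter_right U.closed_of_finiteDimensional).image ?_
    fun_prop
  refine hcpt.isGreatest_sSup ?_
  obtain ⟨x, hx, hx0⟩ := U.exists_mem_ne_zero_of_ne_bot hU
  exact ⟨_, ‖x‖⁻¹ • x, by simp [norm_smul, hx0], U.smul_mem _ hx, rfl⟩

/-!
At every frequency the total variation distance dominates half the distance of the characteristic
functions. At a frequency `w` with `wᵀ S w ≤ 1` the common Gaussian factor `exp (-wᵀ S w / 2)` is
bounded below, so what remains is to find such a `w` at which `e^{i⟪w, μ₀⟫} + e^{i⟪w, μ₁⟫}` and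
`e^{i⟪w, μ₀'⟫} + e^{i⟪w, μ₁'⟫}` are far apart. In midpoint coordinates their difference has real
and imaginary parts `4 sin X sin Y cos B` and `4 cos X cos Y sin B` up to a phase, where
`2 (X ± Y)`, `2 (B ± X)` and `2 (B ± Y)` are, up to sign, the projections of the vectors in `S₁`,
`S₂` and `S₃`. Some direction of the span has non-negligible projections of all three longest
vectors, and shrinking the frequency along that direction makes one of the two products large.
If the two gaps are at most half the shift `v₂`, the direction of `v₂` alone suffices.
-/

open scoped RealInnerProductSpace

section TotalVariation

variable {Ω : Type*} [MeasurableSpace Ω] {f f' : Measure Ω}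

lemma measureReal_sub_le_tvDist [IsFiniteMeasure f] {A : Set Ω} (hA : MeasurableSet A) :
    f.real A - f'.real A ≤ tvDist f f' := by
  refine le_csSup ⟨f.real Set.univ, ?_⟩ ⟨A, hA, rfl⟩
  rintro r ⟨B, -, rfl⟩
  exact (sub_le_self _ measureReal_nonneg).trans (measureReal_mono (Set.subset_univ B))

lemma tvDist_nonneg [IsFiniteMeasure f] : 0 ≤ tvDist f f' := by
  simpa using measureReal_sub_le_tvDist (f := f) (f' := f') MeasurableSet.empty

-- By the layer-cake formula, the difference of the integrals is the integral over the levels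
-- `t ∈ (0, M]` of the difference of the measures of `{t ≤ g}`.
lemma integral_sub_integral_le_mul_tvDist [IsFiniteMeasure f] [IsFiniteMeasure f']
    {g : Ω → ℝ} {M : ℝ} (hg : Measurable g) (hM : 0 ≤ M) (h0 : ∀ x, 0 ≤ g x)
    (hgM : ∀ x, g x ≤ M) :
    ∫ x, g x ∂f - ∫ x, g x ∂f' ≤ M * tvDist f f' := by
  have layer_cake (ν : Measure Ω) [IsFiniteMeasure ν] :
      ∫ x, g x ∂ν = ∫ t in Set.Ioc 0 M, ν.real {a | t ≤ g a} :=
    Integrable.integral_eq_integral_Ioc_meas_le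
      (Integrable.of_bound hg.aestronglyMeasurable M
        (.of_forall fun x => (Real.norm_of_nonneg (h0 x)).trans_le (hgM x)))
      (.of_forall h0) (.of_forall hgM)
  have integrable_levels (ν : Measure Ω) [IsFiniteMeasure ν] :
      IntegrableOn (fun t : ℝ => ν.real {a | t ≤ g a}) (Set.Ioc 0 M) := by
    have hanti : Antitone fun t : ℝ => ν.real {a | t ≤ g a} := fun s t hst =>
      measureReal_mono fun a (ha : t ≤ g a) => hst.trans ha
    exact ((hanti.antitoneOn _).integrableOn_isCompact isCompact_Icc).mono_set
      Set.Ioc_subset_Icc_self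
  rw [layer_cake f, layer_cake f', ← integral_sub (integrable_levels f) (integrable_levels f')]
  calc ∫ t in Set.Ioc 0 M, (f.real {a | t ≤ g a} - f'.real {a | t ≤ g a})
      ≤ ∫ _t in Set.Ioc 0 M, tvDist f f' :=
        integral_mono ((integrable_levels f).sub (integrable_levels f')) (integrable_const _)
          fun t => measureReal_sub_le_tvDist (hg measurableSet_Ici)
    _ = M * tvDist f f' := by simp [hM]

lemma integral_sub_integral_le_two_mul_tvDist [IsProbabilityMeasure f] [IsProbabilityMeasure f']
    {g : Ω → ℝ} {C : ℝ} (hg : Measurable g) (hgC : ∀ x, |g x| ≤ C) :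
    ∫ x, g x ∂f - ∫ x, g x ∂f' ≤ 2 * C * tvDist f f' := by
  have hC : 0 ≤ C := by
    obtain ⟨x⟩ := nonempty_of_isProbabilityMeasure f
    exact (abs_nonneg _).trans (hgC x)
  have integral_shift (ν : Measure Ω) [IsProbabilityMeasure ν] :
      ∫ x, (g x + C) ∂ν = ∫ x, g x ∂ν + C := by
    rw [integral_add (Integrable.of_bound hg.aestronglyMeasurable C (.of_forall hgC))
      (integrable_const C)]
    simp
  have h := integral_sub_integral_le_mul_tvDist (f := f) (f' := f') (hg.add_const C)
    (M := 2 * C) (by positivity) (fun x => by linarith [(abs_le.1 (hgC x)).1])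
    (fun x => by linarith [(abs_le.1 (hgC x)).2])
  rwa [integral_shift, integral_shift, add_sub_add_right_eq_sub] at h

lemma norm_integral_sub_integral_le_two_mul_tvDist {𝕜 : Type*} [RCLike 𝕜]
    [IsProbabilityMeasure f] [IsProbabilityMeasure f'] {g : Ω → 𝕜} {C : ℝ} (hg : Measurable g)
    (hgC : ∀ x, ‖g x‖ ≤ C) :
    ‖∫ x, g x ∂f - ∫ x, g x ∂f'‖ ≤ 2 * C * tvDist f f' := by
  obtain ⟨c, hc, hnorm⟩ := RCLike.exists_norm_eq_mul_self (∫ x, g x ∂f - ∫ x, g x ∂f')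
  have integral_re_mul (ν : Measure Ω) [IsProbabilityMeasure ν] :
      ∫ x, RCLike.re (c * g x) ∂ν = RCLike.re (c * ∫ x, g x ∂ν) := by
    have hint : Integrable g ν := Integrable.of_bound hg.aestronglyMeasurable C (.of_forall hgC)
    rw [← integral_const_mul, integral_re (hint.const_mul c)]
  calc ‖∫ x, g x ∂f - ∫ x, g x ∂f'‖
      = RCLike.re (c * (∫ x, g x ∂f - ∫ x, g x ∂f')) := by rw [← hnorm, RCLike.ofReal_re]
    _ = ∫ x, RCLike.re (c * g x) ∂f - ∫ x, RCLike.re (c * g x) ∂f' := by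
        rw [integral_re_mul, integral_re_mul, mul_sub, map_sub]
    _ ≤ 2 * C * tvDist f f' :=
        integral_sub_integral_le_two_mul_tvDist (by fun_prop) fun x =>
          (RCLike.abs_re_le_norm _).trans (by simpa [hc] using hgC x)

lemma norm_charFun_sub_charFun_le_two_mul_tvDist {E : Type*} [NormedAddCommGroup E]
    [InnerProductSpace ℝ E] [MeasurableSpace E] [OpensMeasurableSpace E] {f f' : Measure E}
    [IsProbabilityMeasure f] [IsProbabilityMeasure f'] (w : E) :
    ‖charFun f w - charFun f' w‖ ≤ 2 * tvDist f f' := by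
  simpa only [charFun_apply, mul_one] using norm_integral_sub_integral_le_two_mul_tvDist
    (f := f) (f' := f') (g := fun x => Complex.exp (⟪x, w⟫ * Complex.I)) (C := 1)
    (Continuous.measurable (by fun_prop)) fun x => (Complex.norm_exp_ofReal_mul_I _).le

end TotalVariation

section ExpSumDist

/-- The modulus of `(e^{i a₀} + e^{i a₁}) - (e^{i b₀} + e^{i b₁})`. It is twice the distance at
frequency `1` of the characteristic functions of the uniform distributions on the points `a₀, a₁`
and `b₀, b₁`; rescaling all four points amounts to changing the frequency. -/
noncomputable def expSumDist (a₀ a₁ b₀ b₁ : ℝ) : ℝ :=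
  ‖(Complex.exp (a₀ * Complex.I) + Complex.exp (a₁ * Complex.I)) -
    (Complex.exp (b₀ * Complex.I) + Complex.exp (b₁ * Complex.I))‖

-- `2 B` is the distance of the two midpoints, and `2 (X + Y)`, `2 (Y - X)` are the two gaps.
lemma exists_midpoint_coordinates (a₀ a₁ b₀ b₁ : ℝ) :
    ∃ θ B X Y : ℝ, a₀ = θ - B - X - Y ∧ a₁ = θ - B + X + Y ∧
      b₀ = θ + B + X - Y ∧ b₁ = θ + B - X + Y :=
  ⟨(a₀ + a₁ + b₀ + b₁) / 4, (b₀ + b₁ - a₀ - a₁) / 4, (a₁ - a₀ + b₀ - b₁) / 4,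
    (a₁ - a₀ - b₀ + b₁) / 4, by ring, by ring, by ring, by ring⟩

lemma expSumDist_midpoint_coordinates (θ B X Y : ℝ) :
    expSumDist (θ - B - X - Y) (θ - B + X + Y) (θ + B + X - Y) (θ + B - X + Y) =
      4 * ‖(⟨Real.sin X * Real.sin Y * Real.cos B, Real.cos X * Real.cos Y * Real.sin B⟩ : ℂ)‖ := by
  have factor :
      (Complex.exp ((θ - B - X - Y : ℝ) * Complex.I) +
          Complex.exp ((θ - B + X + Y : ℝ) * Complex.I)) -
        (Complex.exp ((θ + B + X - Y : ℝ) * Complex.I) +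
          Complex.exp ((θ + B - X + Y : ℝ) * Complex.I)) =
      -4 * Complex.exp (θ * Complex.I) *
        ⟨Real.sin X * Real.sin Y * Real.cos B, Real.cos X * Real.cos Y * Real.sin B⟩ := by
    rw [Complex.mk_eq_add_mul_I]
    push_cast
    simp only [add_mul, sub_eq_add_neg, Complex.exp_add, Complex.exp_mul_I, Complex.cos_neg,
      Complex.sin_neg]
    linear_combination (4 * (Complex.cos θ + Complex.sin θ * Complex.I) * Complex.cos B *
      Complex.sin X * Complex.sin Y) * Complex.I_sq
  rw [expSumDist, factor, norm_mul, norm_mul, Complex.norm_exp_ofReal_mul_I, norm_neg,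
    Complex.norm_ofNat, mul_one]

lemma four_mul_abs_sin_mul_sin_mul_cos_le_expSumDist (t θ B X Y : ℝ) :
    4 * |Real.sin (t * X) * Real.sin (t * Y) * Real.cos (t * B)| ≤
      expSumDist (t * (θ - B - X - Y)) (t * (θ - B + X + Y)) (t * (θ + B + X - Y))
        (t * (θ + B - X + Y)) := by
  simp only [mul_add, mul_sub, expSumDist_midpoint_coordinates]
  gcongr
  exact Complex.abs_re_le_norm ⟨_, _⟩

lemma four_mul_abs_cos_mul_cos_mul_sin_le_expSumDist (t θ B X Y : ℝ) :
    4 * |Real.cos (t * X) * Real.cos (t * Y) * Real.sin (t * B)| ≤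
      expSumDist (t * (θ - B - X - Y)) (t * (θ - B + X + Y)) (t * (θ + B + X - Y))
        (t * (θ + B - X + Y)) := by
  simp only [mul_add, mul_sub, expSumDist_midpoint_coordinates]
  gcongr
  exact Complex.abs_im_le_norm ⟨_, _⟩

end ExpSumDist

section Trigonometry

open Set (Icc)

lemma abs_div_two_le_abs_sin {x : ℝ} (hx : |x| ≤ 1) : |x| / 2 ≤ |Real.sin x| := by
  have hπ : 1 / 2 ≤ 2 / Real.pi := by
    rw [div_le_div_iff₀ two_pos Real.pi_pos]
    linarith [Real.pi_le_four]
  calc |x| / 2 = 1 / 2 * |x| := by ring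
    _ ≤ 2 / Real.pi * |x| := by gcongr
    _ ≤ |Real.sin x| := Real.mul_abs_le_abs_sin (by linarith [Real.pi_gt_three])

lemma half_le_abs_cos {x : ℝ} (hx : |x| ≤ 1) : 1 / 2 ≤ |Real.cos x| := by
  have hsq : x ^ 2 ≤ 1 := (sq_le_one_iff_abs_le_one x).2 hx
  exact le_trans (by linarith [Real.one_sub_sq_div_two_le_cos (x := x)]) (le_abs_self _)

lemma abs_sin_sub_le (x y : ℝ) : |Real.sin (x - y)| ≤ |Real.sin x| + |Real.sin y| :=
  calc |Real.sin (x - y)| = |Real.sin x * Real.cos y - Real.cos x * Real.sin y| := by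
        rw [Real.sin_sub]
    _ ≤ |Real.sin x| * |Real.cos y| + |Real.cos x| * |Real.sin y| := by
        simpa only [abs_mul] using abs_sub (Real.sin x * Real.cos y) (Real.cos x * Real.sin y)
    _ ≤ |Real.sin x| * 1 + 1 * |Real.sin y| := by
        gcongr <;> exact Real.abs_cos_le_one _
    _ = |Real.sin x| + |Real.sin y| := by ring

-- `cos x = 2 cos² (x / 2) - 1`, so the two cosines cannot both be small.
lemma exists_half_le_abs_cos_mul (x : ℝ) : ∃ s ∈ Icc (1 / 2 : ℝ) 1, 1 / 2 ≤ |Real.cos (s * x)| := by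
  by_contra! h
  have h_one : |Real.cos x| < 1 / 2 := by simpa using h 1 (by norm_num)
  have h_half : |Real.cos (1 / 2 * x)| < 1 / 2 := h (1 / 2) (by norm_num)
  have double : Real.cos x = 2 * Real.cos (1 / 2 * x) ^ 2 - 1 := by
    rw [← Real.cos_two_mul]
    ring_nf
  rw [abs_lt] at h_one
  nlinarith [sq_abs (Real.cos (1 / 2 * x)), abs_nonneg (Real.cos (1 / 2 * x))]

-- For `|x| > 1` the points `x` and `x - x / (2 |x|)` differ by `1 / 2` in absolute value, so the
-- sines there cannot both be small.
lemma exists_min_one_le_abs_sin_mul (x : ℝ) :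
    ∃ s ∈ Icc (1 / 2 : ℝ) 1, min 1 |x| ≤ 8 * |Real.sin (s * x)| := by
  rcases le_or_gt |x| 1 with hx | hx
  · refine ⟨1, by norm_num, ?_⟩
    rw [one_mul]
    linarith [abs_div_two_le_abs_sin hx, min_le_right 1 |x|, abs_nonneg x]
  have : 0 < |x| := one_pos.trans hx
  set s := 1 - 1 / (2 * |x|) with hs
  have hsub : |x - s * x| = 1 / 2 := by
    rw [show x - s * x = x / (2 * |x|) by rw [hs]; ring, abs_div, abs_mul, abs_two, abs_abs]
    field_simp
  have hsum : 1 / 4 ≤ |Real.sin x| + |Real.sin (s * x)| :=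
    calc (1 / 4 : ℝ) = |x - s * x| / 2 := by rw [hsub]; norm_num
      _ ≤ |Real.sin (x - s * x)| := abs_div_two_le_abs_sin (by rw [hsub]; norm_num)
      _ ≤ |Real.sin x| + |Real.sin (s * x)| := abs_sin_sub_le _ _
  rcases le_total |Real.sin (s * x)| |Real.sin x| with h | h
  · refine ⟨1, by norm_num, ?_⟩
    rw [one_mul]
    linarith [min_le_left 1 |x|]
  · have hinv : 1 / (2 * |x|) ≤ 1 / 2 := by gcongr; linarith
    have hinv0 : 0 < 1 / (2 * |x|) := by positivity
    exact ⟨s, ⟨by linarith, by linarith⟩, by linarith [min_le_left 1 |x|]⟩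

lemma exists_abs_mul_le_one (x : ℝ) :
    ∃ τ ∈ Icc (0 : ℝ) 1, |τ * x| ≤ 1 ∧ ∀ y, |x| ≤ |y| → min 1 |y| ≤ |τ * y| := by
  rcases le_or_gt |x| 1 with hx | hx
  · exact ⟨1, by norm_num, by simpa using hx, fun y _ => by simp⟩
  have hx0 : 0 < |x| := one_pos.trans hx
  refine ⟨|x|⁻¹, ⟨by positivity, inv_le_one_of_one_le₀ hx.le⟩, ?_, fun y hy => ?_⟩
  · rw [abs_mul, abs_inv, abs_abs, inv_mul_cancel₀ hx0.ne']
  · rw [abs_mul, abs_inv, abs_abs, inv_mul_eq_div]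
    exact (min_le_left _ _).trans ((one_le_div hx0).2 hy)

lemma abs_div_four_le_abs_sin_mul {s x : ℝ} (hs : s ∈ Icc (1 / 2 : ℝ) 1) (hx : |x| ≤ 1) :
    |x| / 4 ≤ |Real.sin (s * x)| := by
  have hsx : |s * x| = s * |x| := by rw [abs_mul, abs_of_nonneg (by linarith [hs.1] : 0 ≤ s)]
  calc |x| / 4 = 1 / 2 * |x| / 2 := by ring
    _ ≤ |s * x| / 2 := by rw [hsx]; gcongr; exact hs.1
    _ ≤ |Real.sin (s * x)| :=
        abs_div_two_le_abs_sin (hsx ▸ mul_le_one₀ hs.2 (abs_nonneg x) hx)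

lemma half_le_abs_cos_mul {s x : ℝ} (hs : s ∈ Icc (1 / 2 : ℝ) 1) (hx : |x| ≤ 1) :
    1 / 2 ≤ |Real.cos (s * x)| := by
  refine half_le_abs_cos ?_
  rw [abs_mul, abs_of_nonneg (by linarith [hs.1] : 0 ≤ s)]
  exact mul_le_one₀ hs.2 (abs_nonneg x) hx

lemma mul_mem_Icc_zero_one {s τ : ℝ} (hs : s ∈ Icc (1 / 2 : ℝ) 1) (hτ : τ ∈ Icc (0 : ℝ) 1) :
    s * τ ∈ Icc (0 : ℝ) 1 :=
  unitInterval.mul_mem (Set.Icc_subset_Icc_left (by norm_num) hs) hτ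

lemma exists_min_one_le_abs_cos_cos_sin {X B : ℝ} (Y : ℝ) (hXB : |X| ≤ |B|) :
    ∃ t ∈ Icc (0 : ℝ) 1,
      min 1 |B| ≤ 16 * |Real.cos (t * X) * Real.cos (t * Y) * Real.sin (t * B)| := by
  obtain ⟨τ, hτ, hB, hle⟩ := exists_abs_mul_le_one B
  obtain ⟨s, hs, hcosY⟩ := exists_half_le_abs_cos_mul (τ * Y)
  have hX : |τ * X| ≤ 1 := by
    refine le_trans ?_ hB
    rw [abs_mul, abs_mul]
    gcongr
  refine ⟨s * τ, mul_mem_Icc_zero_one hs hτ, ?_⟩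
  simp only [mul_assoc s τ, abs_mul (_ * _) (Real.sin _), abs_mul (Real.cos _)]
  calc min 1 |B| ≤ |τ * B| := hle B le_rfl
    _ = 16 * (1 / 2 * (1 / 2) * (|τ * B| / 4)) := by ring
    _ ≤ 16 * (|Real.cos (s * (τ * X))| * |Real.cos (s * (τ * Y))| *
          |Real.sin (s * (τ * B))|) := by
        gcongr
        exacts [half_le_abs_cos_mul hs hX, abs_div_four_le_abs_sin_mul hs hB]

lemma exists_min_one_mul_min_one_le_abs_sin_sin_cos {X Y B : ℝ} (hBX : |B| ≤ |X|)
    (hXY : |X| ≤ |Y|) :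
    ∃ t ∈ Icc (0 : ℝ) 1, min 1 |X| * min 1 |Y| ≤
      64 * |Real.sin (t * X) * Real.sin (t * Y) * Real.cos (t * B)| := by
  obtain ⟨τ, hτ, hX, hle⟩ := exists_abs_mul_le_one X
  obtain ⟨s, hs, hsinY⟩ := exists_min_one_le_abs_sin_mul (τ * Y)
  have hB : |τ * B| ≤ 1 := by
    refine le_trans ?_ hX
    rw [abs_mul, abs_mul]
    gcongr
  refine ⟨s * τ, mul_mem_Icc_zero_one hs hτ, ?_⟩
  simp only [mul_assoc s τ, abs_mul (_ * _) (Real.cos _), abs_mul (Real.sin _)]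
  calc min 1 |X| * min 1 |Y|
      ≤ |τ * X| * min 1 |τ * Y| :=
        mul_le_mul (hle X le_rfl) (le_min (min_le_left _ _) (hle Y hXY)) (by positivity)
          (abs_nonneg _)
    _ ≤ |τ * X| * (8 * |Real.sin (s * (τ * Y))|) := by gcongr
    _ = 64 * (|τ * X| / 4 * |Real.sin (s * (τ * Y))| * (1 / 2)) := by ring
    _ ≤ 64 * (|Real.sin (s * (τ * X))| * |Real.sin (s * (τ * Y))| *
          |Real.cos (s * (τ * B))|) := by
        gcongr
        exacts [abs_div_four_le_abs_sin_mul hs hX, half_le_abs_cos_mul hs hB]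

lemma min_one_le_mul_min_one {k a b : ℝ} (hk : 1 ≤ k) (h : a ≤ k * b) :
    min 1 a ≤ k * min 1 b := by
  rw [mul_min_of_nonneg _ _ (by linarith), mul_one]
  exact min_le_min hk h

lemma exists_min_one_mul_min_one_le_max {X Y B p m : ℝ} (hm0 : 0 ≤ m)
    (hp : p ≤ 2 * (|X| + |Y|)) (hX : m ≤ 2 * (|B| + |X|)) (hY : m ≤ 2 * (|B| + |Y|)) :
    ∃ t ∈ Icc (0 : ℝ) 1, min 1 p * min 1 m ≤
      1024 * max |Real.sin (t * X) * Real.sin (t * Y) * Real.cos (t * B)|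
        |Real.cos (t * X) * Real.cos (t * Y) * Real.sin (t * B)| := by
  wlog hXY : |X| ≤ |Y| generalizing X Y
  · obtain ⟨t, ht, h⟩ := this (X := Y) (Y := X) (by linarith) hY hX (le_of_not_ge hXY)
    exact ⟨t, ht, by rwa [mul_comm (Real.sin (t * X)), mul_comm (Real.cos (t * X))]⟩
  rcases le_total |X| |B| with hXB | hBX
  · obtain ⟨t, ht, h⟩ := exists_min_one_le_abs_cos_cos_sin Y hXB
    refine ⟨t, ht, ?_⟩
    calc min 1 p * min 1 m ≤ 1 * (4 * min 1 |B|) := by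
          gcongr
          exacts [min_le_left _ _, min_one_le_mul_min_one (by norm_num) (by linarith)]
      _ ≤ 1024 * |Real.cos (t * X) * Real.cos (t * Y) * Real.sin (t * B)| := by
          linarith [abs_nonneg (Real.cos (t * X) * Real.cos (t * Y) * Real.sin (t * B))]
      _ ≤ _ := by gcongr; exact le_max_right _ _
  · obtain ⟨t, ht, h⟩ := exists_min_one_mul_min_one_le_abs_sin_sin_cos hBX hXY
    refine ⟨t, ht, ?_⟩
    calc min 1 p * min 1 m ≤ (4 * min 1 |Y|) * (4 * min 1 |X|) := by
          gcongr <;> exact min_one_le_mul_min_one (by norm_num) (by linarith)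
      _ ≤ 1024 * |Real.sin (t * X) * Real.sin (t * Y) * Real.cos (t * B)| := by linarith
      _ ≤ _ := by gcongr; exact le_max_left _ _

lemma max_abs_le_two_mul_abs_add_abs {u v x y : ℝ} (hu : u = 2 * (x + y)) (hv : v = 2 * (x - y)) :
    max |u| |v| ≤ 2 * (|x| + |y|) := by
  rw [hu, hv, abs_mul, abs_mul, abs_two]
  exact max_le (by gcongr; exact abs_add_le x y) (by gcongr; exact abs_sub x y)

lemma exists_min_one_mul_min_one_le_expSumDist {a₀ a₁ b₀ b₁ p m : ℝ} (hm0 : 0 ≤ m)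
    (hp : p ≤ max |a₁ - a₀| |b₁ - b₀|) (hm : m ≤ max |b₀ - a₀| |b₁ - a₁|)
    (hm' : m ≤ max |b₀ - a₁| |b₁ - a₀|) :
    ∃ t ∈ Icc (0 : ℝ) 1,
      min 1 p * min 1 m ≤ 256 * expSumDist (t * a₀) (t * a₁) (t * b₀) (t * b₁) := by
  obtain ⟨θ, B, X, Y, rfl, rfl, rfl, rfl⟩ := exists_midpoint_coordinates a₀ a₁ b₀ b₁
  rw [max_comm] at hm'
  have hpXY : p ≤ 2 * (|Y| + |X|) :=
    hp.trans (max_abs_le_two_mul_abs_add_abs (by ring) (by ring))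
  have hmX : m ≤ 2 * (|B| + |X|) :=
    hm.trans (max_abs_le_two_mul_abs_add_abs (by ring) (by ring))
  have hmY : m ≤ 2 * (|B| + |Y|) :=
    hm'.trans (max_abs_le_two_mul_abs_add_abs (by ring) (by ring))
  obtain ⟨t, ht, h⟩ := exists_min_one_mul_min_one_le_max (p := p) hm0 (by linarith) hmX hmY
  have hmax := max_le (four_mul_abs_sin_mul_sin_mul_cos_le_expSumDist t θ B X Y)
    (four_mul_abs_cos_mul_cos_mul_sin_le_expSumDist t θ B X Y)
  rw [← mul_max_of_nonneg _ _ (by norm_num)] at hmax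
  exact ⟨t, ht, by linarith⟩

-- Here `|X| ≤ r / 4 ≤ |B|`, so the product `cos X * cos Y * sin B` alone suffices.
lemma exists_min_one_le_expSumDist {a₀ a₁ b₀ b₁ r : ℝ} (ha : |a₁ - a₀| ≤ r / 2)
    (hb : |b₁ - b₀| ≤ r / 2) (hr : r ≤ max |b₀ - a₀| |b₁ - a₁|) :
    ∃ t ∈ Icc (0 : ℝ) 1, min 1 r ≤ 16 * expSumDist (t * a₀) (t * a₁) (t * b₀) (t * b₁) := by
  obtain ⟨θ, B, X, Y, rfl, rfl, rfl, rfl⟩ := exists_midpoint_coordinates a₀ a₁ b₀ b₁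
  have hX : |X| ≤ r / 4 := by
    rw [abs_le] at ha hb ⊢
    constructor <;> linarith
  have hrB : r ≤ 2 * (|B| + |X|) :=
    hr.trans (max_abs_le_two_mul_abs_add_abs (by ring) (by ring))
  obtain ⟨t, ht, h⟩ := exists_min_one_le_abs_cos_cos_sin (X := X) (B := B) Y (by linarith)
  refine ⟨t, ht, ?_⟩
  linarith [min_one_le_mul_min_one (k := 4) (b := |B|) (by norm_num) (by linarith : r ≤ 4 * |B|),
    four_mul_abs_cos_mul_cos_mul_sin_le_expSumDist t θ B X Y]

end Trigonometry

section GaussianMixture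

open Set (Icc)

variable {d : ℕ} {S : Matrix (Fin d) (Fin d) ℝ}

instance isProbabilityMeasure_gaussianMixture (μ₀ μ₁ : EuclideanSpace ℝ (Fin d))
    (S : Matrix (Fin d) (Fin d) ℝ) : IsProbabilityMeasure (gaussianMixture μ₀ μ₁ S) :=
  ⟨by simp [gaussianMixture, ENNReal.inv_two_add_inv_two]⟩

lemma charFun_gaussianMixture (hS : S.PosSemidef) (μ₀ μ₁ w : EuclideanSpace ℝ (Fin d)) :
    charFun (gaussianMixture μ₀ μ₁ S) w =
      (Real.exp (-(w.ofLp ⬝ᵥ (S *ᵥ w.ofLp)) / 2) / 2 : ℝ) *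
        (Complex.exp (⟪w, μ₀⟫ * Complex.I) + Complex.exp (⟪w, μ₁⟫ * Complex.I)) := by
  have hint (ν : Measure (EuclideanSpace ℝ (Fin d))) [IsProbabilityMeasure ν] :
      Integrable (fun x => Complex.exp (⟪x, w⟫ * Complex.I)) ((2⁻¹ : ℝ≥0∞) • ν) :=
    (Integrable.of_bound (Continuous.aestronglyMeasurable (by fun_prop)) 1
      (.of_forall fun x => (Complex.norm_exp_ofReal_mul_I _).le)).smul_measure (by simp)
  have average : charFun (gaussianMixture μ₀ μ₁ S) w =
      (charFun (multivariateGaussian μ₀ S) w + charFun (multivariateGaussian μ₁ S) w) / 2 := by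
    simp only [charFun_apply, gaussianMixture]
    rw [integral_add_measure (hint _) (hint _), integral_smul_measure, integral_smul_measure]
    simp only [ENNReal.toReal_inv, ENNReal.toReal_ofNat, Complex.real_smul, Complex.ofReal_inv,
      Complex.ofReal_ofNat]
    ring
  rw [average, charFun_multivariateGaussian hS, charFun_multivariateGaussian hS, Complex.exp_sub,
    Complex.exp_sub]
  push_cast
  rw [neg_div, Complex.exp_neg]
  ring

lemma expSumDist_inner_le_tvDist_gaussianMixture (hS : S.PosSemidef)
    (μ₀ μ₁ μ₀' μ₁' w : EuclideanSpace ℝ (Fin d)) :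
    expSumDist ⟪w, μ₀⟫ ⟪w, μ₁⟫ ⟪w, μ₀'⟫ ⟪w, μ₁'⟫ ≤
      4 * Real.exp (w.ofLp ⬝ᵥ (S *ᵥ w.ofLp) / 2) *
        tvDist (gaussianMixture μ₀ μ₁ S) (gaussianMixture μ₀' μ₁' S) := by
  have h : Real.exp (-(w.ofLp ⬝ᵥ (S *ᵥ w.ofLp)) / 2) / 2 *
        expSumDist ⟪w, μ₀⟫ ⟪w, μ₁⟫ ⟪w, μ₀'⟫ ⟪w, μ₁'⟫ ≤
      2 * tvDist (gaussianMixture μ₀ μ₁ S) (gaussianMixture μ₀' μ₁' S) := by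
    refine le_trans (le_of_eq ?_) (norm_charFun_sub_charFun_le_two_mul_tvDist w)
    rw [charFun_gaussianMixture hS, charFun_gaussianMixture hS, ← mul_sub, norm_mul,
      Complex.norm_real, Real.norm_of_nonneg (by positivity), expSumDist]
  rw [neg_div, Real.exp_neg] at h
  field_simp at h
  linarith

lemma dotProduct_mulVec_smul_self (a : ℝ) (u : EuclideanSpace ℝ (Fin d)) :
    (a • u).ofLp ⬝ᵥ (S *ᵥ (a • u).ofLp) = a ^ 2 * (u.ofLp ⬝ᵥ (S *ᵥ u.ofLp)) := by
  simp only [WithLp.ofLp_smul, Matrix.mulVec_smul, dotProduct_smul, smul_dotProduct, smul_eq_mul]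
  ring

lemma expSumDist_mul_inner_le_tvDist_gaussianMixture (hS : S.PosSemidef)
    (μ₀ μ₁ μ₀' μ₁' : EuclideanSpace ℝ (Fin d)) {w : EuclideanSpace ℝ (Fin d)}
    (hw : w.ofLp ⬝ᵥ (S *ᵥ w.ofLp) ≤ 1) {t : ℝ} (ht : t ∈ Icc (0 : ℝ) 1) :
    expSumDist (t * ⟪w, μ₀⟫) (t * ⟪w, μ₁⟫) (t * ⟪w, μ₀'⟫) (t * ⟪w, μ₁'⟫) ≤
      8 * tvDist (gaussianMixture μ₀ μ₁ S) (gaussianMixture μ₀' μ₁' S) := by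
  have hq : (t • w).ofLp ⬝ᵥ (S *ᵥ (t • w).ofLp) ≤ 1 := by
    rw [dotProduct_mulVec_smul_self]
    exact (mul_le_of_le_one_right (sq_nonneg t) hw).trans (pow_le_one₀ ht.1 ht.2)
  have hexp : Real.exp ((t • w).ofLp ⬝ᵥ (S *ᵥ (t • w).ofLp) / 2) ≤ 2 :=
    (Real.le_log_iff_exp_le two_pos).1 (by linarith [Real.log_two_gt_d9])
  simp only [← real_inner_smul_left]
  calc _ ≤ 4 * Real.exp ((t • w).ofLp ⬝ᵥ (S *ᵥ (t • w).ofLp) / 2) *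
        tvDist (gaussianMixture μ₀ μ₁ S) (gaussianMixture μ₀' μ₁' S) :=
        expSumDist_inner_le_tvDist_gaussianMixture hS μ₀ μ₁ μ₀' μ₁' (t • w)
    _ ≤ 4 * 2 * tvDist (gaussianMixture μ₀ μ₁ S) (gaussianMixture μ₀' μ₁' S) := by
        gcongr
        exact tvDist_nonneg
    _ = 8 * tvDist (gaussianMixture μ₀ μ₁ S) (gaussianMixture μ₀' μ₁' S) := by ring

end GaussianMixture

section Directions

variable {E : Type*} [NormedAddCommGroup E] [InnerProductSpace ℝ E]

lemma exists_norm_smul_le_mul_norm_le_abs_inner_add (u v : E) {ε : ℝ} (hε : 0 ≤ ε) :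
    ∃ a : ℝ, ‖a • v‖ ≤ ε ∧ ε * ‖v‖ ≤ |⟪u + a • v, v⟫| := by
  rcases eq_or_ne v 0 with rfl | hv
  · exact ⟨0, by simpa using hε, by simp⟩
  have hnorm : ‖(ε / ‖v‖) • v‖ = ε := by
    rw [norm_smul, Real.norm_of_nonneg (by positivity), div_mul_cancel₀ _ (norm_ne_zero_iff.2 hv)]
  have hinner : ⟪(ε / ‖v‖) • v, v⟫ = ε * ‖v‖ := by
    rw [real_inner_smul_left, real_inner_self_eq_norm_mul_norm]
    field_simp
  rcases le_total 0 ⟪u, v⟫ with h | h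
  · refine ⟨ε / ‖v‖, hnorm.le, le_trans ?_ (le_abs_self _)⟩
    rw [inner_add_left, hinner]
    exact le_add_of_nonneg_left h
  · refine ⟨-(ε / ‖v‖), by rw [neg_smul, norm_neg, hnorm], le_trans ?_ (neg_le_abs _)⟩
    rw [neg_smul, inner_add_left, inner_neg_left, hinner]
    linarith

lemma exists_mem_span_forall_mul_norm_le_abs_inner (s : Finset E) :
    ∃ u ∈ Submodule.span ℝ (s : Set E), ‖u‖ ≤ 1 - (1 / 2) ^ s.card ∧
      ∀ v ∈ s, (1 / 2) ^ s.card * ‖v‖ ≤ |⟪u, v⟫| := by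
  classical
  induction s using Finset.induction_on with
  | empty => exact ⟨0, zero_mem _, by simp, by simp⟩
  | insert v s hv ih =>
    obtain ⟨u, hu, hnorm, hinner⟩ := ih
    set ε : ℝ := (1 / 2) ^ s.card
    have hcard : (1 / 2 : ℝ) ^ (insert v s).card = ε / 2 := by
      rw [Finset.card_insert_of_notMem hv, pow_succ]
      ring
    obtain ⟨a, ha, hav⟩ :=
      exists_norm_smul_le_mul_norm_le_abs_inner_add u v (by positivity : 0 ≤ ε / 2)
    rw [hcard]
    refine ⟨u + a • v, ?_, ?_, Finset.forall_mem_insert _ _ _ |>.2 ⟨hav, fun x hx => ?_⟩⟩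
    · exact add_mem (Submodule.span_mono (by simp) hu)
        (Submodule.smul_mem _ a (Submodule.subset_span (by simp)))
    · linarith [norm_add_le u (a • v)]
    · have hperturb : |⟪a • v, x⟫| ≤ ε / 2 * ‖x‖ :=
        (abs_real_inner_le_norm _ _).trans (by gcongr)
      rw [inner_add_left]
      linarith [hinner x hx, abs_sub_abs_le_abs_add ⟪u, x⟫ ⟪a • v, x⟫]

end Directions

section LambdaMax

variable {d : ℕ} {S : Matrix (Fin d) (Fin d) ℝ} {U : Submodule ℝ (EuclideanSpace ℝ (Fin d))}

lemma lambdaMax_pos (hS : S.PosDef) (hU : U ≠ ⊥) : 0 < lambdaMax S U := by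
  obtain ⟨⟨u, hu, -, h⟩, -⟩ := isGreatest_lambdaMax S U hU
  have hu0 : u.ofLp ≠ 0 := (WithLp.ofLp_eq_zero 2).not.2 (norm_ne_zero_iff.1 (by simp [hu]))
  rw [h]
  simpa using hS.dotProduct_mulVec_pos hu0

lemma dotProduct_mulVec_le_lambdaMax_mul_norm_sq {u : EuclideanSpace ℝ (Fin d)} (hu : u ∈ U) :
    u.ofLp ⬝ᵥ (S *ᵥ u.ofLp) ≤ lambdaMax S U * ‖u‖ ^ 2 := by
  rcases eq_or_ne u 0 with rfl | hu0
  · simp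
  have hU : U ≠ ⊥ := U.ne_bot_iff.2 ⟨u, hu, hu0⟩
  have h : (‖u‖⁻¹ • u).ofLp ⬝ᵥ (S *ᵥ (‖u‖⁻¹ • u).ofLp) ≤ lambdaMax S U :=
    (isGreatest_lambdaMax S U hU).2
      ⟨‖u‖⁻¹ • u, by simp [norm_smul, hu0], U.smul_mem _ hu, rfl⟩
  rwa [dotProduct_mulVec_smul_self, inv_pow, inv_mul_le_iff₀' (by positivity)] at h

end LambdaMax

section LowerBounds

variable {d : ℕ} {S : Matrix (Fin d) (Fin d) ℝ} {μ₀ μ₁ μ₀' μ₁' : EuclideanSpace ℝ (Fin d)}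
  {lam : ℝ}

lemma abs_inner_le_max_of_mem_pair {E : Type*} [NormedAddCommGroup E] [InnerProductSpace ℝ E]
    {v x₀ x₁ y₀ y₁ : E} (hv : v ∈ ({x₁ - x₀, y₁ - y₀} : Set E)) (w : E) :
    |⟪w, v⟫| ≤ max |⟪w, x₁⟫ - ⟪w, x₀⟫| |⟪w, y₁⟫ - ⟪w, y₀⟫| := by
  rw [← inner_sub_right, ← inner_sub_right]
  rcases hv with rfl | rfl
  exacts [le_max_left _ _, le_max_right _ _]

lemma exists_dotProduct_mulVec_le_one_forall_le_abs_inner (hlam : 0 < lam)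
    {s : Finset (EuclideanSpace ℝ (Fin d))}
    (hq : ∀ u ∈ Submodule.span ℝ (s : Set (EuclideanSpace ℝ (Fin d))),
      u.ofLp ⬝ᵥ (S *ᵥ u.ofLp) ≤ lam * ‖u‖ ^ 2) :
    ∃ w : EuclideanSpace ℝ (Fin d), w.ofLp ⬝ᵥ (S *ᵥ w.ofLp) ≤ 1 ∧
      ∀ v ∈ s, (1 / 2) ^ s.card * (‖v‖ / √lam) ≤ |⟪w, v⟫| := by
  obtain ⟨u, hu, hnorm, hinner⟩ := exists_mem_span_forall_mul_norm_le_abs_inner s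
  have hnorm1 : ‖u‖ ≤ 1 := hnorm.trans (sub_le_self _ (by positivity))
  refine ⟨(√lam)⁻¹ • u, ?_, fun v hv => ?_⟩
  · rw [dotProduct_mulVec_smul_self, inv_pow, Real.sq_sqrt hlam.le, inv_mul_le_iff₀ hlam]
    refine (hq u hu).trans ?_
    gcongr
    exact pow_le_one₀ (norm_nonneg u) hnorm1
  · rw [real_inner_smul_left, abs_mul, abs_of_pos (by positivity), inv_mul_eq_div, ← mul_div_assoc]
    gcongr
    exact hinner v hv

lemma min_one_mul_min_one_le_tvDist_gaussianMixture (hS : S.PosSemidef) (hlam : 0 < lam)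
    {v₁ v₂ v₃ : EuclideanSpace ℝ (Fin d)} (h₁ : v₁ ∈ ({μ₁ - μ₀, μ₁' - μ₀'} : Set _))
    (h₂ : v₂ ∈ ({μ₀' - μ₀, μ₁' - μ₁} : Set _)) (h₃ : v₃ ∈ ({μ₀' - μ₁, μ₁' - μ₀} : Set _))
    (hq : ∀ u ∈ Submodule.span ℝ {v₁, v₂, v₃}, u.ofLp ⬝ᵥ (S *ᵥ u.ofLp) ≤ lam * ‖u‖ ^ 2) :
    min 1 (‖v₁‖ / √lam) * min 1 (min ‖v₂‖ ‖v₃‖ / √lam) ≤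
      2 ^ 17 * tvDist (gaussianMixture μ₀ μ₁ S) (gaussianMixture μ₀' μ₁' S) := by
  classical
  obtain ⟨w, hw, hinner⟩ := exists_dotProduct_mulVec_le_one_forall_le_abs_inner
    (s := {v₁, v₂, v₃}) hlam (by simpa using hq)
  have hwv {v} (hv : v ∈ ({v₁, v₂, v₃} : Finset _)) : ‖v‖ / √lam / 8 ≤ |⟪w, v⟫| :=
    calc ‖v‖ / √lam / 8 = (1 / 2) ^ 3 * (‖v‖ / √lam) := by ring
      _ ≤ (1 / 2) ^ ({v₁, v₂, v₃} : Finset _).card * (‖v‖ / √lam) :=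
          mul_le_mul_of_nonneg_right
            (pow_le_pow_of_le_one (by norm_num) (by norm_num) Finset.card_le_three) (by positivity)
      _ ≤ |⟪w, v⟫| := hinner v hv
  have h23 {v} (hv : v ∈ ({v₁, v₂, v₃} : Finset _)) (hmin : min ‖v₂‖ ‖v₃‖ ≤ ‖v‖) :
      min ‖v₂‖ ‖v₃‖ / √lam / 8 ≤ |⟪w, v⟫| :=
    le_trans (by gcongr) (hwv hv)
  obtain ⟨t, ht, h⟩ := exists_min_one_mul_min_one_le_expSumDist
    (p := ‖v₁‖ / √lam / 8) (m := min ‖v₂‖ ‖v₃‖ / √lam / 8) (by positivity)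
    ((hwv (by simp)).trans (abs_inner_le_max_of_mem_pair h₁ w))
    ((h23 (by simp) (min_le_left _ _)).trans (abs_inner_le_max_of_mem_pair h₂ w))
    ((h23 (by simp) (min_le_right _ _)).trans (abs_inner_le_max_of_mem_pair h₃ w))
  have hscale (r : ℝ) : min 1 r ≤ 8 * min 1 (r / 8) :=
    min_one_le_mul_min_one (by norm_num) (by linarith)
  calc min 1 (‖v₁‖ / √lam) * min 1 (min ‖v₂‖ ‖v₃‖ / √lam)
      ≤ (8 * min 1 (‖v₁‖ / √lam / 8)) * (8 * min 1 (min ‖v₂‖ ‖v₃‖ / √lam / 8)) := by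
        gcongr <;> exact hscale _
    _ ≤ 2 ^ 17 * tvDist (gaussianMixture μ₀ μ₁ S) (gaussianMixture μ₀' μ₁' S) := by
        linarith [expSumDist_mul_inner_le_tvDist_gaussianMixture hS μ₀ μ₁ μ₀' μ₁' hw ht]

lemma min_one_le_tvDist_gaussianMixture (hS : S.PosSemidef) (hlam : 0 < lam)
    {v : EuclideanSpace ℝ (Fin d)} (hv : v ∈ ({μ₀' - μ₀, μ₁' - μ₁} : Set _))
    (hμ : ‖μ₁ - μ₀‖ ≤ ‖v‖ / 2) (hμ' : ‖μ₁' - μ₀'‖ ≤ ‖v‖ / 2)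
    (hq : v.ofLp ⬝ᵥ (S *ᵥ v.ofLp) ≤ lam * ‖v‖ ^ 2) :
    min 1 (‖v‖ / √lam) ≤
      2 ^ 7 * tvDist (gaussianMixture μ₀ μ₁ S) (gaussianMixture μ₀' μ₁' S) := by
  rcases eq_or_ne v 0 with rfl | hv0
  · simpa using tvDist_nonneg
  set w := (‖v‖ * √lam)⁻¹ • v
  have hw : w.ofLp ⬝ᵥ (S *ᵥ w.ofLp) ≤ 1 := by
    rw [dotProduct_mulVec_smul_self, inv_pow, mul_pow, Real.sq_sqrt hlam.le,
      inv_mul_le_iff₀ (by positivity), mul_one, mul_comm]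
    exact hq
  have hwnorm : ‖w‖ = 1 / √lam := by
    rw [norm_smul, Real.norm_of_nonneg (by positivity)]
    field_simp
  have hwv : |⟪w, v⟫| = ‖v‖ / √lam := by
    rw [real_inner_smul_left, real_inner_self_eq_norm_sq, abs_of_nonneg (by positivity)]
    field_simp
  have hgap {x y : EuclideanSpace ℝ (Fin d)} (h : ‖y - x‖ ≤ ‖v‖ / 2) :
      |⟪w, y⟫ - ⟪w, x⟫| ≤ ‖v‖ / √lam / 2 :=
    calc |⟪w, y⟫ - ⟪w, x⟫| ≤ ‖w‖ * ‖y - x‖ := by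
          rw [← inner_sub_right]
          exact abs_real_inner_le_norm _ _
      _ ≤ 1 / √lam * (‖v‖ / 2) := by rw [hwnorm]; gcongr
      _ = ‖v‖ / √lam / 2 := by ring
  obtain ⟨t, ht, h⟩ := exists_min_one_le_expSumDist (hgap hμ) (hgap hμ')
    (hwv.symm.trans_le (abs_inner_le_max_of_mem_pair hv w))
  linarith [expSumDist_mul_inner_le_tvDist_gaussianMixture hS μ₀ μ₁ μ₀' μ₁' hw ht]

lemma min_one_mul_le_mul_min_one_mul_min_one {C P N : ℝ} (hP : 0 ≤ P) (hN : 0 ≤ N) (hC : 2 ≤ C)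
    (hPC : P ≤ C) (hNP : N ≤ 2 * P) : min 1 (P * N) ≤ C * (min 1 P * min 1 N) := by
  rcases le_total P 1 with hP1 | hP1 <;> rcases le_total N 1 with hN1 | hN1 <;>
    simp only [min_eq_left, min_eq_right, hP1, hN1, one_mul, mul_one]
  · exact (min_le_right _ _).trans (le_mul_of_one_le_left (by positivity) (by linarith))
  · exact (min_le_left _ _).trans (by nlinarith)
  · exact (min_le_right _ _).trans (by gcongr)
  · exact (min_le_left _ _).trans (by linarith)

lemma min_one_le_mul_min_one_mul_min_one {C P N : ℝ} (hN : 0 ≤ N) (hC : 1 ≤ C)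
    (hCP : 1 ≤ C * P) : min 1 N ≤ C * (min 1 P * min 1 N) := by
  rw [← mul_assoc]
  refine le_mul_of_one_le_left (by positivity) ?_
  simpa using min_one_le_mul_min_one hC hCP

lemma min_one_mul_div_le_tvDist_gaussianMixture (hS : S.PosSemidef) (hlam : 0 < lam)
    {v₁ v₂ v₃ : EuclideanSpace ℝ (Fin d)} (h₁ : v₁ ∈ ({μ₁ - μ₀, μ₁' - μ₀'} : Set _))
    (h₂ : v₂ ∈ ({μ₀' - μ₀, μ₁' - μ₁} : Set _)) (h₃ : v₃ ∈ ({μ₀' - μ₁, μ₁' - μ₀} : Set _))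
    (hq : ∀ u ∈ Submodule.span ℝ {v₁, v₂, v₃}, u.ofLp ⬝ᵥ (S *ᵥ u.ofLp) ≤ lam * ‖u‖ ^ 2)
    {C : ℝ} (hC : 2 ≤ C) (hv₁ : ‖v₁‖ ≤ C * √lam) (hmin : min ‖v₂‖ ‖v₃‖ / 2 ≤ ‖v₁‖) :
    min 1 (‖v₁‖ * min ‖v₂‖ ‖v₃‖ / lam) ≤
      C * 2 ^ 17 * tvDist (gaussianMixture μ₀ μ₁ S) (gaussianMixture μ₀' μ₁' S) := by
  have hσ : 0 < √lam := Real.sqrt_pos.2 hlam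
  calc min 1 (‖v₁‖ * min ‖v₂‖ ‖v₃‖ / lam)
      = min 1 (‖v₁‖ / √lam * (min ‖v₂‖ ‖v₃‖ / √lam)) := by
        rw [div_mul_div_comm, Real.mul_self_sqrt hlam.le]
    _ ≤ C * (min 1 (‖v₁‖ / √lam) * min 1 (min ‖v₂‖ ‖v₃‖ / √lam)) := by
        refine min_one_mul_le_mul_min_one_mul_min_one (by positivity) (by positivity) hC
          ((div_le_iff₀ hσ).2 hv₁) ?_
        rw [← mul_div_assoc]
        gcongr
        linarith
    _ ≤ C * (2 ^ 17 * tvDist (gaussianMixture μ₀ μ₁ S) (gaussianMixture μ₀' μ₁' S)) := by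
        refine mul_le_mul_of_nonneg_left ?_ (by linarith)
        exact min_one_mul_min_one_le_tvDist_gaussianMixture hS hlam h₁ h₂ h₃ hq
    _ = _ := by rw [mul_assoc]

lemma min_one_div_le_tvDist_gaussianMixture (hS : S.PosSemidef) (hlam : 0 < lam)
    {v₁ v₂ v₃ : EuclideanSpace ℝ (Fin d)} (h₁ : v₁ ∈ ({μ₁ - μ₀, μ₁' - μ₀'} : Set _))
    (h₂ : v₂ ∈ ({μ₀' - μ₀, μ₁' - μ₁} : Set _)) (h₃ : v₃ ∈ ({μ₀' - μ₁, μ₁' - μ₀} : Set _))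
    (hq : ∀ u ∈ Submodule.span ℝ {v₁, v₂, v₃}, u.ofLp ⬝ᵥ (S *ᵥ u.ofLp) ≤ lam * ‖u‖ ^ 2)
    {C : ℝ} (hC : 1 ≤ C) (hv₁ : √lam ≤ C * ‖v₁‖) :
    min 1 (min ‖v₂‖ ‖v₃‖ / √lam) ≤
      C * 2 ^ 17 * tvDist (gaussianMixture μ₀ μ₁ S) (gaussianMixture μ₀' μ₁' S) := by
  have hσ : 0 < √lam := Real.sqrt_pos.2 hlam
  calc min 1 (min ‖v₂‖ ‖v₃‖ / √lam)
      ≤ C * (min 1 (‖v₁‖ / √lam) * min 1 (min ‖v₂‖ ‖v₃‖ / √lam)) := by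
        refine min_one_le_mul_min_one_mul_min_one (by positivity) hC ?_
        rwa [← mul_div_assoc, one_le_div hσ]
    _ ≤ C * (2 ^ 17 * tvDist (gaussianMixture μ₀ μ₁ S) (gaussianMixture μ₀' μ₁' S)) := by
        refine mul_le_mul_of_nonneg_left ?_ (by linarith)
        exact min_one_mul_min_one_le_tvDist_gaussianMixture hS hlam h₁ h₂ h₃ hq
    _ = _ := by rw [mul_assoc]

end LowerBounds

theorem theorem1_general :
    ∀ K : ℝ, 0 < K → ∃ c : ℝ, 0 < c ∧
      ∀ (d : ℕ) (S : Matrix (Fin d) (Fin d) ℝ), S.PosSemidef →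
      ∀ μ₀ μ₁ μ₀' μ₁' v₁ v₂ v₃ : EuclideanSpace ℝ (Fin d),
        IsLongestIn {μ₁ - μ₀, μ₁' - μ₀'} v₁ →
        v₂ ∈ ({μ₀' - μ₀, μ₁' - μ₁} : Set (EuclideanSpace ℝ (Fin d))) →
        v₃ ∈ ({μ₀' - μ₁, μ₁' - μ₀} : Set (EuclideanSpace ℝ (Fin d))) →
        ∀ lam : ℝ, lam = lambdaMax S (Submodule.span ℝ {v₁, v₂, v₃}) →
          (Submodule.span ℝ {v₁, v₂, v₃} ≠ ⊥ → 0 < lam) →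
          ((min ‖v₂‖ ‖v₃‖ / 2 ≤ ‖v₁‖ ∧ K * ‖v₁‖ ≤ √lam) →
            c * min 1 (‖v₁‖ * min ‖v₂‖ ‖v₃‖ / lam) ≤
              tvDist (gaussianMixture μ₀ μ₁ S) (gaussianMixture μ₀' μ₁' S)) ∧
          (¬ (min ‖v₂‖ ‖v₃‖ / 2 ≤ ‖v₁‖ ∧ K * ‖v₁‖ ≤ √lam) →
            c * min 1 (min ‖v₂‖ ‖v₃‖ / √lam) ≤
              tvDist (gaussianMixture μ₀ μ₁ S) (gaussianMixture μ₀' μ₁' S)) := by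
  intro K hK
  have hKinv : 0 < K⁻¹ := inv_pos.2 hK
  refine ⟨((2 + K + K⁻¹) * 2 ^ 17)⁻¹, by positivity, ?_⟩
  intro d S hS μ₀ μ₁ μ₀' μ₁' v₁ v₂ v₃ h₁ h₂ h₃ lam hlam hpos
  rcases eq_or_ne (Submodule.span ℝ {v₁, v₂, v₃}) ⊥ with hU | hU
  · have hv₂ : v₂ = 0 := Submodule.span_eq_bot.1 hU v₂ (by simp)
    simp [hv₂, tvDist_nonneg]
  have hσ : 0 < √lam := Real.sqrt_pos.2 (hpos hU)
  have hq : ∀ u ∈ Submodule.span ℝ {v₁, v₂, v₃}, u.ofLp ⬝ᵥ (S *ᵥ u.ofLp) ≤ lam * ‖u‖ ^ 2 :=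
    fun u hu => hlam ▸ dotProduct_mulVec_le_lambdaMax_mul_norm_sq hu
  rw [inv_mul_le_iff₀ (by positivity), inv_mul_le_iff₀ (by positivity)]
  refine ⟨fun ⟨hmin, hK₁⟩ => ?_, fun hnot => ?_⟩
  · refine min_one_mul_div_le_tvDist_gaussianMixture hS (hpos hU) h₁.1 h₂ h₃ hq (by linarith) ?_
      hmin
    calc ‖v₁‖ = K⁻¹ * (K * ‖v₁‖) := by field_simp
      _ ≤ (2 + K + K⁻¹) * √lam := by gcongr; linarith
  rcases lt_or_ge ‖v₁‖ (min ‖v₂‖ ‖v₃‖ / 2) with hlt | hge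
  · have hgap : ‖v₁‖ ≤ ‖v₂‖ / 2 := by linarith [min_le_left ‖v₂‖ ‖v₃‖]
    calc min 1 (min ‖v₂‖ ‖v₃‖ / √lam) ≤ min 1 (‖v₂‖ / √lam) := by
          gcongr
          exact min_le_left _ _
      _ ≤ 2 ^ 7 * tvDist (gaussianMixture μ₀ μ₁ S) (gaussianMixture μ₀' μ₁' S) :=
          min_one_le_tvDist_gaussianMixture hS (hpos hU) h₂ ((h₁.2 _ (by simp)).trans hgap)
            ((h₁.2 _ (by simp)).trans hgap) (hq v₂ (Submodule.subset_span (by simp)))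
      _ ≤ _ := mul_le_mul_of_nonneg_right (by linarith) tvDist_nonneg
  · refine min_one_div_le_tvDist_gaussianMixture hS (hpos hU) h₁.1 h₂ h₃ hq (by linarith) ?_
    have hK₁ : √lam < K * ‖v₁‖ := not_le.1 fun h => hnot ⟨hge, h⟩
    exact hK₁.le.trans (by gcongr; linarith)

theorem theorem1 :
    ∀ K : ℝ, 0 < K → ∃ c : ℝ, 0 < c ∧
      ∀ (d : ℕ) (S : Matrix (Fin d) (Fin d) ℝ), S.PosDef →
      ∀ μ₀ μ₁ μ₀' μ₁' v₁ v₂ v₃ : EuclideanSpace ℝ (Fin d),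
        IsLongestIn {μ₁ - μ₀, μ₁' - μ₀'} v₁ →
        IsLongestIn {μ₀' - μ₀, μ₁' - μ₁} v₂ →
        IsLongestIn {μ₀' - μ₁, μ₁' - μ₀} v₃ →
        ∀ lam : ℝ, lam = lambdaMax S (Submodule.span ℝ {v₁, v₂, v₃}) →
          ((min ‖v₂‖ ‖v₃‖ / 2 ≤ ‖v₁‖ ∧ K * ‖v₁‖ ≤ √lam) →
            c * min 1 (‖v₁‖ * min ‖v₂‖ ‖v₃‖ / lam) ≤
              tvDist (gaussianMixture μ₀ μ₁ S) (gaussianMixture μ₀' μ₁' S)) ∧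
          (¬ (min ‖v₂‖ ‖v₃‖ / 2 ≤ ‖v₁‖ ∧ K * ‖v₁‖ ≤ √lam) →
            c * min 1 (min ‖v₂‖ ‖v₃‖ / √lam) ≤
              tvDist (gaussianMixture μ₀ μ₁ S) (gaussianMixture μ₀' μ₁' S)) := by
  intro K hK
  obtain ⟨c, hc, h⟩ := theorem1_general K hK
  exact ⟨c, hc, fun d S hS μ₀ μ₁ μ₀' μ₁' v₁ v₂ v₃ h₁ h₂ h₃ lam hlam =>
    h d S hS.posSemidef μ₀ μ₁ μ₀' μ₁' v₁ v₂ v₃ h₁ h₂.1 h₃.1 lam hlam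
      fun hU => hlam ▸ lambdaMax_pos hS hU⟩
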